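/- Let $M$ be a smooth ($C^\infty$) finite-dimensional Hausdorff manifold and $\mathbf{T}M=TM\oplus T^*M$ its big tangent bundle, with the neutral metric $g((X,\alpha),(Y,\mu))=\alpha(Y)+\mu(X)$, the Courant bracket $$[(X,\alpha),(Y,\mu)]=\big([X,Y],\,L_X\mu-L_Y\alpha+\tfrac12 d(\alpha(Y)-\mu(X))\big)$$ and the projection $\mathrm{pr}_{TM}(X,\alpha)=X$. Let $G$ be a generalized Riemannian metric on $M$, i.e. $G(\mathcal X,\mathcal Y)=g(\phi\mathcal X,\mathcal Y)$ is positive definite, where $\phi\in End(\mathbf{T}M)$ satisfies $\phi^2=Id$ and $g(\phi\mathcal X,\phi\mathcal Y)=g(\mathcal X,\mathcal Y)$. Let $E\subseteq\mathbf{T}M$ be a smooth subbundle of constant rank that is $g$-isotropic ($g|_E=0$). A generalized, metric, 2-nilpotent structure with image $E$ is a $\tau\in End(\mathbf{T}M)$ of constant rank with $\tau^2=0$, $g(\mathcal X,\tau\mathcal Y)+g(\tau\mathcal X,\mathcal Y)=0$, $im\,\tau=E$ and $G(\tau\mathcal X,\tau\mathcal Y)=G(\mathcal X,\mathcal Y)$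 for all $\mathcal X,\mathcal Y\in\phi(E)$. It is integrable if $$\mathcal N_\tau(\mathcal X,\mathcal Y)=[\tau\mathcal X,\tau\mathcal Y]-\tau[\mathcal X,\tau\mathcal Y]-\tau[\tau\mathcal X,\mathcal Y]+\tau^2[\mathcal X,\mathcal Y]=0\qquad\forall\,\mathcal X,\mathcal Y\in\Gamma\mathbf{T}M.$$ A complex structure on $E$ compatible with $G|_E$ is a $\lambda\in End(E)$ with $\lambda^2=-Id$ and $G(\lambda e_1,\lambda e_2)=G(e_1,e_2)$ for all $e_1,e_2\in E$. Then $\tau\mapsto\lambda=\tau\circ\phi|_E$ is a bijection from the set of generalized, metric, 2-nilpotent structures $\tau$ with $im\,\tau=E$ onto the set of complex structures $\lambda$ on $E$ compatible with $G|_E$. Moreover, such a $\tau$ is integrable if and only if $E$ is closed under Courant brackets and $(G|_E,\lambda)$ is an almost Kähler structure on the Lie algebroid $E$ (with the Courant bracket and the anchor $\mathrm{pr}_{TM}|_E$); that is, the fundamental form $\omega\in\Gamma\wedge^2E^*$, $\omega(e_1,e_2)=G(\lambda e_1,e_2)$, satisfies $d_E\omega=0$, where $$\begin{aligned}d_E\omega(e_1,e_2,e_3)={}&\mathrm{pr}_{TM}e_1(\omega(e_2,e_3))-\mathrm{pr}_{TM}e_2(\omega(e_1,e_3))+\mathrm{pr}_{TM}e_3(\omega(e_1,e_2))\\&-\omega([e_1,e_2],e_3)+\omega([e_1,e_3],e_2)-\omega([e_2,e_3],e_1),\qquad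 e_1,e_2,e_3\in\Gamma E.\end{aligned}$$ -/

import Mathlib

open scoped Manifold ContDiff
open Bundle VectorField

noncomputable section

namespace GenGeom

section BigTangentBundle

variable (V : Type*) [NormedAddCommGroup V] [NormedSpace ℝ V]
  {M : Type*} [TopologicalSpace M] [ChartedSpace V M]

/-- The cotangent space `T*ₓM`. -/
abbrev Cotangent (x : M) : Type _ := TangentSpace 𝓘(ℝ, V) x →L[ℝ] ℝ

/-- The fibre at `x` of the big tangent bundle `𝐓M = TM ⊕ T*M`; its elements are the pairs
`(X, α)`. -/
abbrev BigTangent (x : M) : Type _ := TangentSpace 𝓘(ℝ, V) x × Cotangent V x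

/-- The neutral metric `g((X, α), (Y, μ)) = α(Y) + μ(X)` of the big tangent bundle. -/
def neutral (x : M) : BigTangent V x →ₗ[ℝ] BigTangent V x →ₗ[ℝ] ℝ :=
  LinearMap.mk₂ ℝ (fun a b : BigTangent V x => a.2 b.1 + b.2 a.1)
    (fun a a' b => by
      simp only [Prod.fst_add, Prod.snd_add, map_add, add_apply]; ring)
    (fun c a b => by
      simp only [Prod.smul_fst, Prod.smul_snd, map_smul, smul_apply,
        smul_eq_mul]; ring)
    (fun a b b' => by
      simp only [Prod.fst_add, Prod.snd_add, map_add, add_apply]; ring)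
    (fun c a b => by
      simp only [Prod.smul_fst, Prod.smul_snd, map_smul, smul_apply,
        smul_eq_mul]; ring)

/-- The Lie derivative `L_X μ` of a `1`-form along a vector field. At `x` it is computed in the
chart around `x`: there `(L_X μ)(v) = (Dμ · X)(v) + μ(DX · v)`, and the resulting covector is
pulled back to `TₓM` by the differential of the chart. -/
def lieDerivForm (X : ∀ x : M, TangentSpace 𝓘(ℝ, V) x) (μ : ∀ x : M, Cotangent V x) (x : M) :
    Cotangent V x :=
  let ψ : V → M := (extChartAt 𝓘(ℝ, V) x).symm
  let y : V := extChartAt 𝓘(ℝ, V) x x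
  let Xc : V → V := fun z => mpullback 𝓘(ℝ, V) 𝓘(ℝ, V) ψ X z
  let μc : V → V →L[ℝ] ℝ := fun z => (μ (ψ z)).comp (mfderiv 𝓘(ℝ, V) 𝓘(ℝ, V) ψ z)
  (fderiv ℝ μc y (Xc y) + (μc y).comp (fderiv ℝ Xc y)).comp
    (mfderiv 𝓘(ℝ, V) 𝓘(ℝ, V) (extChartAt 𝓘(ℝ, V) x) x)

/-- The Courant bracket
`[(X, α), (Y, μ)] = ([X, Y], L_X μ - L_Y α + ½ d(α(Y) - μ(X)))`. -/
def courant (a b : ∀ x : M, BigTangent V x) (x : M) : BigTangent V x :=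
  (mlieBracket 𝓘(ℝ, V) (fun y => (a y).1) (fun y => (b y).1) x,
    lieDerivForm V (fun y => (a y).1) (fun y => (b y).2) x
      - lieDerivForm V (fun y => (b y).1) (fun y => (a y).2) x
      + (1 / 2 : ℝ) • mvfderiv 𝓘(ℝ, V) (fun y => (a y).2 (b y).1 - (b y).2 (a y).1) x)

/-- The Courant-Nijenhuis torsion
`N_τ(X, Y) = [τX, τY] - τ[X, τY] - τ[τX, Y] + τ²[X, Y]`. -/
def nijenhuis (τ : ∀ x : M, BigTangent V x →ₗ[ℝ] BigTangent V x)
    (a b : ∀ x : M, BigTangent V x) (x : M) : BigTangent V x :=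
  courant V (fun y => τ y (a y)) (fun y => τ y (b y)) x
    - τ x (courant V a (fun y => τ y (b y)) x)
    - τ x (courant V (fun y => τ y (a y)) b x)
    + τ x (τ x (courant V a b x))

end BigTangentBundle

section Structures

variable (V : Type*) [NormedAddCommGroup V] [NormedSpace ℝ V]
  {M : Type*} [TopologicalSpace M] [ChartedSpace V M] [IsManifold 𝓘(ℝ, V) ∞ M]

/-- A section of the big tangent bundle is smooth on `U` if its vector field and its `1`-form
are. -/
def SmoothSectionOn (a : ∀ x : M, BigTangent V x) (U : Set M) : Prop :=
  ContMDiffOn 𝓘(ℝ, V) (𝓘(ℝ, V).prod 𝓘(ℝ, V)) ∞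
      (fun x => TotalSpace.mk' V (E := fun x : M => TangentSpace 𝓘(ℝ, V) x) x (a x).1) U ∧
    ContMDiffOn 𝓘(ℝ, V) (𝓘(ℝ, V).prod 𝓘(ℝ, V →L[ℝ] ℝ)) ∞
      (fun x => TotalSpace.mk' (V →L[ℝ] ℝ) (E := fun x : M => TangentSpace 𝓘(ℝ, V) x →L[ℝ] ℝ)
        x (a x).2) U

/-- Elements of `Γ𝐓M`. -/
def SmoothSection (a : ∀ x : M, BigTangent V x) : Prop := SmoothSectionOn V a Set.univ

/-- A field of fibrewise endomorphisms is an element of `End(𝐓M)`, i.e. it is smooth, if it maps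
smooth sections to smooth sections. -/
def SmoothEndo (τ : ∀ x : M, BigTangent V x →ₗ[ℝ] BigTangent V x) : Prop :=
  ∀ a : ∀ x : M, BigTangent V x, SmoothSection V a → SmoothSection V (fun x => τ x (a x))

variable (M)

/-- A generalized Riemannian metric `G` on `M`, given by the endomorphism `φ` of `𝐓M` with
`φ² = Id`, `g(φa, φb) = g(a, b)` and such that `G(a, b) = g(φa, b)` is positive definite. -/
structure GenRiemannianMetric where
  φ : ∀ x : M, BigTangent V x →ₗ[ℝ] BigTangent V x
  smooth : SmoothEndo V φ
  φ_sq : ∀ (x : M) (a : BigTangent V x), φ x (φ x a) = a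
  φ_isometry : ∀ (x : M) (a b : BigTangent V x),
    neutral V x (φ x a) (φ x b) = neutral V x a b
  pos : ∀ (x : M) (a : BigTangent V x), a ≠ 0 → 0 < neutral V x (φ x a) a

/-- A smooth subbundle of `𝐓M`: a family of subspaces of the fibres which, around each point, is
spanned by a smooth local frame with a fixed number of elements. -/
structure Subbundle where
  fiber : ∀ x : M, Submodule ℝ (BigTangent V x)
  rank : ℕ
  exists_frame : ∀ x₀ : M, ∃ U : Set M, IsOpen U ∧ x₀ ∈ U ∧
    ∃ s : Fin rank → ∀ x : M, BigTangent V x,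
      (∀ i, SmoothSectionOn V (s i) U) ∧
      ∀ x ∈ U, LinearIndependent ℝ (fun i => s i x) ∧
        Submodule.span ℝ (Set.range fun i => s i x) = fiber x

variable {M}

/-- The positive definite metric `G(a, b) = g(φa, b)`. -/
def GenRiemannianMetric.form (G : GenRiemannianMetric V M) (x : M) :
    BigTangent V x →ₗ[ℝ] BigTangent V x →ₗ[ℝ] ℝ :=
  (neutral V x).comp (G.φ x)

/-- `E` is `g`-isotropic (big-isotropic). -/
def Subbundle.IsIsotropic (E : Subbundle V M) : Prop :=
  ∀ x : M, ∀ a ∈ E.fiber x, ∀ b ∈ E.fiber x, neutral V x a b = 0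

/-- Elements of `ΓE`. -/
def Subbundle.IsSection (E : Subbundle V M) (e : ∀ x : M, E.fiber x) : Prop :=
  SmoothSection V (fun x => (e x : BigTangent V x))

/-- `E` is closed under Courant brackets. -/
def Subbundle.CourantClosed (E : Subbundle V M) : Prop :=
  ∀ e₁ e₂ : ∀ x : M, E.fiber x, E.IsSection V e₁ → E.IsSection V e₂ →
    ∀ x : M, courant V (fun y => (e₁ y : BigTangent V y)) (fun y => (e₂ y : BigTangent V y)) x
      ∈ E.fiber x

/-- Generalized 2-nilpotent structures: smooth, `g`-skew-symmetric endomorphisms of `𝐓M` of square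
zero and of constant rank. -/
structure IsTwoNilpotent (τ : ∀ x : M, BigTangent V x →ₗ[ℝ] BigTangent V x) : Prop where
  smooth : SmoothEndo V τ
  sq : ∀ (x : M) (a : BigTangent V x), τ x (τ x a) = 0
  skew : ∀ (x : M) (a b : BigTangent V x), neutral V x a (τ x b) + neutral V x (τ x a) b = 0
  const_rank : ∃ k : ℕ, ∀ x : M, Module.finrank ℝ (LinearMap.range (τ x)) = k

/-- `G` and `τ` are compatible: `G(τa, τb) = G(a, b)` for `a, b ∈ φ(im τ)`. -/
def IsCompatible (G : GenRiemannianMetric V M)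
    (τ : ∀ x : M, BigTangent V x →ₗ[ℝ] BigTangent V x) : Prop :=
  ∀ x : M, ∀ a ∈ (LinearMap.range (τ x)).map (G.φ x),
    ∀ b ∈ (LinearMap.range (τ x)).map (G.φ x),
      G.form V x (τ x a) (τ x b) = G.form V x a b

/-- `τ` is integrable: its Courant-Nijenhuis torsion vanishes. -/
def IsIntegrable (τ : ∀ x : M, BigTangent V x →ₗ[ℝ] BigTangent V x) : Prop :=
  ∀ a b : ∀ x : M, BigTangent V x, SmoothSection V a → SmoothSection V b →
    ∀ x : M, nijenhuis V τ a b x = 0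

/-- The set of generalized, metric, 2-nilpotent structures `τ` on `(M, G)` with `im τ = E`. -/
def MetricTwoNilpotent (G : GenRiemannianMetric V M) (E : Subbundle V M) :
    Set (∀ x : M, BigTangent V x →ₗ[ℝ] BigTangent V x) :=
  {τ | IsTwoNilpotent V τ ∧ (∀ x : M, LinearMap.range (τ x) = E.fiber x) ∧ IsCompatible V G τ}

/-- `(G|_E, lam)` is an almost Hermitian structure on `E`: `lam` is a smooth field of endomorphisms
of `E` with `lam² = -Id` (a complex structure on `E`) and it is compatible with `G|_E`. -/
structure IsAlmostHermitian (G : GenRiemannianMetric V M) (E : Subbundle V M)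
    (lam : ∀ x : M, E.fiber x →ₗ[ℝ] E.fiber x) : Prop where
  smooth : ∀ e : ∀ x : M, E.fiber x, E.IsSection V e → E.IsSection V (fun x => lam x (e x))
  sq : ∀ (x : M) (e : E.fiber x), lam x (lam x e) = -e
  compat : ∀ (x : M) (e₁ e₂ : E.fiber x),
    G.form V x (lam x e₁ : BigTangent V x) (lam x e₂ : BigTangent V x)
      = G.form V x (e₁ : BigTangent V x) (e₂ : BigTangent V x)

/-- The set of complex structures on `E` that are compatible with `G|_E`. -/
def CompatibleComplex (G : GenRiemannianMetric V M) (E : Subbundle V M) :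
    Set (∀ x : M, E.fiber x →ₗ[ℝ] E.fiber x) :=
  {lam | IsAlmostHermitian V G E lam}

/-- The bracket of the Lie algebroid `E` (the Courant bracket); its anchor is the projection
`(X, α) ↦ X`. -/
def Subbundle.bracket (E : Subbundle V M) (hE : E.CourantClosed V) (e₁ e₂ : ∀ x : M, E.fiber x)
    (h₁ : E.IsSection V e₁) (h₂ : E.IsSection V e₂) (x : M) : E.fiber x :=
  ⟨courant V (fun y => (e₁ y : BigTangent V y)) (fun y => (e₂ y : BigTangent V y)) x,
    hE e₁ e₂ h₁ h₂ x⟩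

/-- The value `(d_E η)(e₁, e₂, e₃)` of the Lie algebroid differential of a `2`-form `η` on `E`. -/
def Subbundle.dTwoForm (E : Subbundle V M) (hE : E.CourantClosed V)
    (η : ∀ x : M, E.fiber x →ₗ[ℝ] E.fiber x →ₗ[ℝ] ℝ) (e₁ e₂ e₃ : ∀ x : M, E.fiber x)
    (h₁ : E.IsSection V e₁) (h₂ : E.IsSection V e₂) (h₃ : E.IsSection V e₃) (x : M) : ℝ :=
  mvfderiv 𝓘(ℝ, V) (fun y => η y (e₂ y) (e₃ y)) x (e₁ x : BigTangent V x).1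
    - mvfderiv 𝓘(ℝ, V) (fun y => η y (e₁ y) (e₃ y)) x (e₂ x : BigTangent V x).1
    + mvfderiv 𝓘(ℝ, V) (fun y => η y (e₁ y) (e₂ y)) x (e₃ x : BigTangent V x).1
    - η x (E.bracket V hE e₁ e₂ h₁ h₂ x) (e₃ x)
    + η x (E.bracket V hE e₁ e₃ h₁ h₃ x) (e₂ x)
    - η x (E.bracket V hE e₂ e₃ h₂ h₃ x) (e₁ x)

/-- The fundamental form `ω(e₁, e₂) = G(lam e₁, e₂)` of `(G|_E, lam)`; equivalently
`G(e₁, e₂) = ω(e₁, lam e₂)`. -/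
def fundamentalForm (G : GenRiemannianMetric V M) (E : Subbundle V M)
    (lam : ∀ x : M, E.fiber x →ₗ[ℝ] E.fiber x) (x : M) :
    E.fiber x →ₗ[ℝ] E.fiber x →ₗ[ℝ] ℝ :=
  (G.form V x).compl₁₂ ((E.fiber x).subtype.comp (lam x)) (E.fiber x).subtype

/-- `(G|_E, lam)` is an almost Kähler structure on the Lie algebroid `E`: it is almost Hermitian and
its fundamental form is closed. -/
def IsAlmostKahler (G : GenRiemannianMetric V M) (E : Subbundle V M) (hE : E.CourantClosed V)
    (lam : ∀ x : M, E.fiber x →ₗ[ℝ] E.fiber x) : Prop :=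
  IsAlmostHermitian V G E lam ∧
    ∀ (e₁ e₂ e₃ : ∀ x : M, E.fiber x) (h₁ : E.IsSection V e₁) (h₂ : E.IsSection V e₂)
      (h₃ : E.IsSection V e₃) (x : M),
      E.dTwoForm V hE (fundamentalForm V G E lam) e₁ e₂ e₃ h₁ h₂ h₃ x = 0

end Structures

end GenGeom

end

/-!
The Courant bracket satisfies
`pr a (g(b, c)) = g([a, b], c) + g(b, [a, c]) + ½ pr c (g(a, b)) + ½ pr b (g(a, c))`,
which is Cartan's formula `(L_X μ)(Y) = X(μ(Y)) - μ([X, Y])` written out in both components.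
Applied to `τa, b, τc`, where `τ` is skew with `τ² = 0`, and antisymmetrized, it turns
`-g(N_τ(a, b), c)` into `d_Eω(τa, τb, τc)`, because `ω(τa, τc) = g(τa, c)` for the fundamental form
of `λ = τ ∘ φ|_E`. Every section of `E` is of the form `τa`, since `λ² = -Id`, and `g` is
nondegenerate, so `N_τ = 0` says that `E` is closed under brackets and that `ω` is closed.

The inverse of `τ ↦ τ ∘ φ|_E` is `λ ↦ λ ∘ pr_E ∘ φ`, with `pr_E` the `G`-orthogonal projection onto
`E`. It is skew because `λ` is `G`-skew, and its square is zero because `pr_E ∘ φ` vanishes on the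
isotropic `E`. Cramer's rule for the Gram matrix of a local frame shows that `pr_E` is smooth.
-/

noncomputable section

namespace GenGeom

open Filter Topology

section Gram

variable {K W ι : Type*} [Field K] [AddCommGroup W] [Module K W] [Fintype ι] [DecidableEq ι]
  {B : LinearMap.BilinForm K W} {s : ι → W}

lemma det_gram_ne_zero (hB : B.toQuadraticMap.Anisotropic) (hs : LinearIndependent K s) :
    (Matrix.of fun i j => B (s j) (s i)).det ≠ 0 := by
  intro hdet
  obtain ⟨w, hw, hwA⟩ := Matrix.exists_mulVec_eq_zero_iff.2 hdet
  have hwi (i : ι) : B (∑ j, w j • s j) (s i) = 0 := by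
    simpa [Matrix.mulVec, dotProduct, mul_comm] using congrFun hwA i
  have hsum : ∑ j, w j • s j = 0 := hB _ <| by
    simp only [LinearMap.BilinMap.toQuadraticMap_apply]
    rw [map_sum (B (∑ j, w j • s j))]
    exact Finset.sum_eq_zero fun i _ => by rw [map_smul, hwi, smul_zero]
  exact hw (funext (Fintype.linearIndependent_iff.1 hs w hsum))

lemma eq_sum_cramer_gram (hdet : (Matrix.of fun i j => B (s j) (s i)).det ≠ 0) {p : W}
    (hp : p ∈ Submodule.span K (Set.range s)) :
    p = ∑ i, ((Matrix.of fun i j => B (s j) (s i)).det⁻¹ *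
      Matrix.cramer (Matrix.of fun i j => B (s j) (s i)) (fun j => B p (s j)) i) • s i := by
  obtain ⟨c, rfl⟩ := (Submodule.mem_span_range_iff_exists_fun K).1 hp
  set A := Matrix.of fun i j => B (s j) (s i) with hA
  have hAc : (fun j => B (∑ i, c i • s i) (s j)) = A.mulVec c := by
    ext j
    simp [hA, Matrix.mulVec, dotProduct, mul_comm]
  have hcramer : A.cramer (A.mulVec c) = A.det • c := by
    rw [Matrix.cramer_eq_adjugate_mulVec, Matrix.mulVec_mulVec, Matrix.adjugate_mul,
      Matrix.smul_mulVec, Matrix.one_mulVec]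
  rw [hAc, hcramer]
  simp only [Pi.smul_apply, smul_eq_mul, inv_mul_cancel_left₀ hdet]

end Gram

section Det

variable {𝕜 E H M ι : Type*} [NontriviallyNormedField 𝕜] [NormedAddCommGroup E] [NormedSpace 𝕜 E]
  [TopologicalSpace H] {I : ModelWithCorners 𝕜 E H} [TopologicalSpace M] [ChartedSpace H M]
  [Fintype ι] [DecidableEq ι] {n : ℕ∞ω} {A : M → Matrix ι ι 𝕜} {x : M}

lemma contMDiffAt_det (hA : ∀ i j, CMDiffAt n (fun y => A y i j) x) :
    CMDiffAt n (fun y => (A y).det) x := by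
  simp only [Matrix.det_apply']
  exact contMDiffAt_finsetSum fun σ _ =>
    contMDiffAt_const.mul (contMDiffAt_finsetProd fun i _ => hA (σ i) i)

lemma contMDiffAt_cramer {f : M → ι → 𝕜} (hA : ∀ i j, CMDiffAt n (fun y => A y i j) x)
    (hf : ∀ i, CMDiffAt n (fun y => f y i) x) (i : ι) :
    CMDiffAt n (fun y => (A y).cramer (f y) i) x := by
  simp only [Matrix.cramer_apply]
  refine contMDiffAt_det fun k l => ?_
  simp only [Matrix.updateCol_apply]
  split_ifs
  exacts [hf k, hA k l]

end Det

section Chart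

variable {𝕜 E H M : Type*} [NontriviallyNormedField 𝕜] [NormedAddCommGroup E] [NormedSpace 𝕜 E]
  [TopologicalSpace H] {I : ModelWithCorners 𝕜 E H} [TopologicalSpace M] [ChartedSpace H M]
  {F : Type*} [NormedAddCommGroup F] [NormedSpace 𝕜 F]

section Pullback

variable {E' H' M' : Type*} [NormedAddCommGroup E'] [NormedSpace 𝕜 E']
  [TopologicalSpace H'] (I' : ModelWithCorners 𝕜 E' H') [TopologicalSpace M'] [ChartedSpace H' M']

variable (I) in
/-- The pullback `f^*μ` of an `F`-valued `1`-form `μ` along `f`; the counterpart for `1`-forms of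
`VectorField.mpullback`. -/
def mpullbackForm (f : M → M') (μ : ∀ y : M', TangentSpace I' y →L[𝕜] F) (x : M) :
    TangentSpace I x →L[𝕜] F :=
  (μ (f x)).comp (mfderiv I I' f x)

lemma mpullbackForm_apply_mpullback {f : M → M'} {x : M}
    (hf : (mfderiv I I' f x).IsInvertible) (μ : ∀ y : M', TangentSpace I' y →L[𝕜] F)
    (Y : ∀ y : M', TangentSpace I' y) :
    mpullbackForm I I' f μ x (mpullback I I' f Y x) = μ (f x) (Y (f x)) :=
  congrArg (μ (f x)) (hf.self_apply_inverse _)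

end Pullback

variable [I.Boundaryless]

lemma mvfderiv_eq_fderiv_extChartAt_symm {f : M → F} {x : M} (hf : MDiffAt f x)
    (v : TangentSpace I x) :
    mvfderiv I f x v = fderiv 𝕜 (f ∘ (extChartAt I x).symm) (extChartAt I x x) v := by
  simp only [mvfderiv, mfderiv, hf, I.range_eq_univ, fderivWithin_univ,
    writtenInExtChartAt, extChartAt_model_space_eq_id, PartialEquiv.refl_coe, Function.id_comp]
  rfl

lemma isInvertible_mfderiv_extChartAt_symm [IsManifold I 1 M] {x : M} {z : E}
    (hz : z ∈ (extChartAt I x).target) :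
    (mfderiv 𝓘(𝕜, E) I (extChartAt I x).symm z).IsInvertible := by
  have h := isInvertible_mfderivWithin_extChartAt_symm hz
  rwa [I.range_eq_univ, mfderivWithin_univ] at h

lemma mfderiv_extChartAt_symm_self [IsManifold I 1 M] (x : M) :
    mfderiv 𝓘(𝕜, E) I (extChartAt I x).symm (extChartAt I x x) = .id 𝕜 E := by
  have h := mfderivWithin_range_extChartAt_symm (I := I) (x := x)
  rwa [I.range_eq_univ, mfderivWithin_univ] at h

lemma mpullback_extChartAt_symm_self [IsManifold I 1 M] (X : ∀ x : M, TangentSpace I x) (x : M) :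
    mpullback 𝓘(𝕜, E) I (extChartAt I x).symm X (extChartAt I x x) = X x := by
  rw [mpullback_apply, mfderiv_extChartAt_symm_self]
  have hinv : (ContinuousLinearMap.id 𝕜 E).inverse = .id 𝕜 E := ContinuousLinearMap.inverse_id
  have hX : (X ((extChartAt I x).symm (extChartAt I x x)) : E) = X x :=
    congrArg (fun p : M => (X p : E)) (extChartAt_to_inv x)
  exact (congrArg (fun L : E →L[𝕜] E => L _) hinv).trans hX

lemma mpullbackForm_extChartAt_symm_self [IsManifold I 1 M]
    (μ : ∀ x : M, TangentSpace I x →L[𝕜] F) (x : M) :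
    mpullbackForm 𝓘(𝕜, E) I (extChartAt I x).symm μ (extChartAt I x x) = μ x := by
  rw [mpullbackForm, mfderiv_extChartAt_symm_self]
  exact congrArg (fun p : M => (show E →L[𝕜] F from μ p)) (extChartAt_to_inv x)

lemma mlieBracket_eq_lieBracket_mpullback [IsManifold I 1 M]
    (X Y : ∀ x : M, TangentSpace I x) (x : M) :
    mlieBracket I X Y x = lieBracket 𝕜
      (mpullback 𝓘(𝕜, E) I (extChartAt I x).symm X)
      (mpullback 𝓘(𝕜, E) I (extChartAt I x).symm Y) (extChartAt I x x) := by
  rw [mlieBracket, mlieBracketWithin_apply, I.range_eq_univ, Set.preimage_univ, Set.inter_univ,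
    mpullbackWithin_univ, mpullbackWithin_univ, mfderiv_extChartAt_self]
  refine (congrArg (fun L : E →L[𝕜] E => L _) ContinuousLinearMap.inverse_id).trans ?_
  exact congrFun lieBracketWithin_univ _

lemma fderiv_apply_add_apply_fderiv {μ : E → E →L[𝕜] F} {X Y : E → E} {y : E}
    (hμ : DifferentiableAt 𝕜 μ y) (hY : DifferentiableAt 𝕜 Y y) :
    (fderiv 𝕜 μ y (X y) + (μ y).comp (fderiv 𝕜 X y)) (Y y)
      = fderiv 𝕜 (fun z => μ z (Y z)) y (X y) - μ y (lieBracket 𝕜 X Y y) := by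
  rw [fderiv_clm_apply hμ hY, lieBracket]
  simp

lemma differentiableAt_mpullback_extChartAt_symm [IsManifold I 2 M] [CompleteSpace E]
    {X : ∀ x : M, TangentSpace I x} {x : M} (hX : MDiffAt (T% X) x) :
    DifferentiableAt 𝕜 (mpullback 𝓘(𝕜, E) I (extChartAt I x).symm X : E → E)
      (extChartAt I x x) := by
  have hψ : CMDiffAt 2 (extChartAt I x).symm (extChartAt I x x) :=
    (contMDiffOn_extChartAt_symm x).contMDiffAt (extChartAt_target_mem_nhds x)
  have h : MDiffAt (T% (mpullback 𝓘(𝕜, E) I (extChartAt I x).symm X)) (extChartAt I x x) :=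
    MDifferentiableAt.mpullback_vectorField (by rwa [extChartAt_to_inv]) hψ
      (isInvertible_mfderiv_extChartAt_symm (mem_extChartAt_target x)) le_rfl
  exact (((contMDiff_snd_tangentBundle_modelSpace (n := 1) E 𝓘(𝕜, E)).mdifferentiable
    one_ne_zero _).comp _ h).differentiableAt

lemma differentiableAt_mpullbackForm_extChartAt_symm [IsManifold I 2 M]
    {μ : ∀ x : M, TangentSpace I x →L[𝕜] F}
    {x : M} (hμ : MDiffAt (fun y => TotalSpace.mk' (E →L[𝕜] F)
      (E := fun y : M => TangentSpace I y →L[𝕜] F) y (μ y)) x) :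
    DifferentiableAt 𝕜 (F := E →L[𝕜] F) (mpullbackForm 𝓘(𝕜, E) I (extChartAt I x).symm μ)
      (extChartAt I x x) := by
  have hψ : MDiffAt (extChartAt I x).symm (extChartAt I x x) :=
    ((contMDiffOn_extChartAt_symm (n := 1) x).contMDiffAt
      (extChartAt_target_mem_nhds x)).mdifferentiableAt one_ne_zero
  have hcoord := MDifferentiableAt.comp_of_eq (f := (extChartAt I x).symm) (x := extChartAt I x x)
    ((mdifferentiableAt_hom_bundle _).1 hμ).2 hψ (by simp)
  refine (mdifferentiableAt_iff_differentiableAt.1 hcoord).congr_of_eventuallyEq ?_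
  filter_upwards [extChartAt_target_mem_nhds (I := I) x] with z hz
  have hz' : (extChartAt I x).symm z ∈ (chartAt H x).source := by
    simpa only [extChartAt_source] using (extChartAt I x).map_target hz
  have hL := TangentBundle.symmL_trivializationAt (I := I) hz'
  rw [(extChartAt I x).right_inv hz, I.range_eq_univ, mfderivWithin_univ] at hL
  simp only [ContinuousLinearMap.inCoordinates, Trivial.fiberBundle_trivializationAt',
    Trivial.continuousLinearMapAt_trivialization, ContinuousLinearMap.id_comp, Function.comp_apply]
  exact congrArg (fun L => (μ ((extChartAt I x).symm z)).comp L) hL.symm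

end Chart

section CartanFormula

variable {V M : Type*} [NormedAddCommGroup V] [NormedSpace ℝ V]
  [TopologicalSpace M] [ChartedSpace V M]
  {X Y : ∀ x : M, TangentSpace 𝓘(ℝ, V) x} {μ : ∀ x : M, Cotangent V x} {x : M}

lemma mdifferentiableAt_form_apply [IsManifold 𝓘(ℝ, V) 1 M]
    (hμ : MDiffAt (fun y => TotalSpace.mk' (V →L[ℝ] ℝ) (E := Cotangent V) y (μ y)) x)
    (hY : MDiffAt (T% Y) x) : MDiffAt (fun y => μ y (Y y)) x := by
  have h := hμ.clm_bundle_apply (F₁ := V) (F₂ := ℝ) (E₂ := Trivial M ℝ) hY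
  exact ((mdifferentiableAt_totalSpace _ _).1 h).2

lemma lieDerivForm_apply [CompleteSpace V] [IsManifold 𝓘(ℝ, V) 2 M]
    (hμ : MDiffAt (fun y => TotalSpace.mk' (V →L[ℝ] ℝ) (E := Cotangent V) y (μ y)) x)
    (hY : MDiffAt (T% Y) x) :
    lieDerivForm V X μ x (Y x) =
      mvfderiv 𝓘(ℝ, V) (fun y => μ y (Y y)) x (X x) - μ x (mlieBracket 𝓘(ℝ, V) X Y x) := by
  set ψ := (extChartAt 𝓘(ℝ, V) x).symm
  have hpair : (fun y => μ y (Y y)) ∘ ψ =ᶠ[𝓝 (extChartAt 𝓘(ℝ, V) x x)]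
      fun z => (mpullbackForm 𝓘(ℝ, V) 𝓘(ℝ, V) ψ μ z) (mpullback 𝓘(ℝ, V) 𝓘(ℝ, V) ψ Y z) := by
    filter_upwards [extChartAt_target_mem_nhds (I := 𝓘(ℝ, V)) x] with z hz
    exact (mpullbackForm_apply_mpullback _
      (isInvertible_mfderiv_extChartAt_symm hz) μ Y).symm
  have hcartan := fderiv_apply_add_apply_fderiv (X := mpullback 𝓘(ℝ, V) 𝓘(ℝ, V) ψ X)
    (differentiableAt_mpullbackForm_extChartAt_symm hμ)
    (differentiableAt_mpullback_extChartAt_symm hY)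
  rw [mpullback_extChartAt_symm_self, mpullback_extChartAt_symm_self,
    mpullbackForm_extChartAt_symm_self] at hcartan
  rw [mvfderiv_eq_fderiv_extChartAt_symm (mdifferentiableAt_form_apply hμ hY), hpair.fderiv_eq,
    mlieBracket_eq_lieBracket_mpullback, lieDerivForm, mfderiv_extChartAt_self]
  refine Eq.trans ?_ hcartan
  rw [← mpullback_extChartAt_symm_self X x, ← mpullbackForm_extChartAt_symm_self μ x]
  rfl

end CartanFormula

section Sections

variable {V M : Type*} [NormedAddCommGroup V] [NormedSpace ℝ V] [TopologicalSpace M]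
  [ChartedSpace V M] [IsManifold 𝓘(ℝ, V) ∞ M] {a b : ∀ x : M, BigTangent V x} {x : M}

/-- A section of the big tangent bundle is smooth at `x` if its vector field and its `1`-form
are; the pointwise version of `SmoothSectionOn`. -/
def SmoothSectionAt (a : ∀ x : M, BigTangent V x) (x : M) : Prop :=
  CMDiffAt ∞ (fun y => TotalSpace.mk' V (E := fun y : M => TangentSpace 𝓘(ℝ, V) y) y (a y).1) x ∧
    CMDiffAt ∞ (fun y => TotalSpace.mk' (V →L[ℝ] ℝ) (E := Cotangent V) y (a y).2) x

/-- A section of the big tangent bundle is differentiable at `x` if its vector field and its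
`1`-form are. -/
def DifferentiableSectionAt (a : ∀ x : M, BigTangent V x) (x : M) : Prop :=
  MDiffAt (fun y => TotalSpace.mk' V (E := fun y : M => TangentSpace 𝓘(ℝ, V) y) y (a y).1) x ∧
    MDiffAt (fun y => TotalSpace.mk' (V →L[ℝ] ℝ) (E := Cotangent V) y (a y).2) x

lemma smoothSection_iff : SmoothSection V a ↔ ∀ x, SmoothSectionAt a x := by
  simp only [SmoothSection, SmoothSectionOn, contMDiffOn_univ, SmoothSectionAt, ContMDiff,
    forall_and]

lemma SmoothSection.smoothSectionAt (h : SmoothSection V a) (x : M) : SmoothSectionAt a x :=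
  smoothSection_iff.1 h x

lemma SmoothSectionAt.differentiableSectionAt (h : SmoothSectionAt a x) :
    DifferentiableSectionAt a x :=
  ⟨h.1.mdifferentiableAt (by simp), h.2.mdifferentiableAt (by simp)⟩

lemma SmoothSection.differentiableSectionAt (h : SmoothSection V a) (x : M) :
    DifferentiableSectionAt a x :=
  (h.smoothSectionAt x).differentiableSectionAt

lemma SmoothSectionAt.congr_of_eventuallyEq (h : SmoothSectionAt a x)
    (hab : ∀ᶠ y in 𝓝 x, b y = a y) : SmoothSectionAt b x :=
  ⟨h.1.congr_of_eventuallyEq (hab.mono fun _ hy => by simp only [hy]),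
    h.2.congr_of_eventuallyEq (hab.mono fun _ hy => by simp only [hy])⟩

lemma SmoothSectionAt.smul {f : M → ℝ} (hf : CMDiffAt ∞ f x) (h : SmoothSectionAt a x) :
    SmoothSectionAt (fun y => f y • a y) x :=
  ⟨hf.smul_section h.1, hf.smul_section h.2⟩

lemma SmoothSection.neg (h : SmoothSection V a) : SmoothSection V (fun y => -a y) :=
  ⟨h.1.neg_section, h.2.neg_section⟩

lemma SmoothSectionAt.sum {ι : Type*} {s : Finset ι} {a : ι → ∀ x : M, BigTangent V x}
    (h : ∀ i ∈ s, SmoothSectionAt (a i) x) : SmoothSectionAt (fun y => ∑ i ∈ s, a i y) x := by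
  simp only [SmoothSectionAt, Prod.fst_sum, Prod.snd_sum]
  exact ⟨.sum_section fun i hi => (h i hi).1, .sum_section fun i hi => (h i hi).2⟩

lemma contMDiffAt_neutral (ha : SmoothSectionAt a x) (hb : SmoothSectionAt b x) :
    CMDiffAt ∞ (fun y => neutral V y (a y) (b y)) x := by
  have hpair {a b : ∀ x : M, BigTangent V x} (ha : SmoothSectionAt a x)
      (hb : SmoothSectionAt b x) : CMDiffAt ∞ (fun y => (a y).2 (b y).1) x :=
    (contMDiffAt_totalSpace.1
      (ha.2.clm_bundle_apply (F₁ := V) (F₂ := ℝ) (E₂ := Trivial M ℝ) hb.1)).2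
  exact (hpair ha hb).add (hpair hb ha)

variable [FiniteDimensional ℝ V] [T2Space M]

lemma SmoothSectionOn.exists_smoothSection_eventuallyEq {U : Set M} (h : SmoothSectionOn V a U)
    (hU : U ∈ 𝓝 x) : ∃ b : ∀ x : M, BigTangent V x, SmoothSection V b ∧ ∀ᶠ y in 𝓝 x, b y = a y := by
  obtain ⟨f, -, hf⟩ := (SmoothBumpFunction.nhds_basis_tsupport (I := 𝓘(ℝ, V)) x).mem_iff.1
    (interior_mem_nhds.2 hU)
  refine ⟨fun y => f y • a y, ⟨?_, ?_⟩, f.eventuallyEq_one.mono fun y hy => ?_⟩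
  · exact (ContMDiffOn.smul_section_of_tsupport f.contMDiff.contMDiffOn isOpen_interior hf
      (h.1.mono interior_subset)).contMDiffOn
  · exact (ContMDiffOn.smul_section_of_tsupport f.contMDiff.contMDiffOn isOpen_interior hf
      (h.2.mono interior_subset)).contMDiffOn
  · simp only [hy, Pi.one_apply, one_smul]

lemma exists_smoothSection_eq (c : BigTangent V x) :
    ∃ a : ∀ x : M, BigTangent V x, SmoothSection V a ∧ a x = c := by
  obtain ⟨s, hs, hXs⟩ := FiberBundle.exists_contMDiffOn_extend (k := ∞) 𝓘(ℝ, V) V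
    (V := fun x : M => TangentSpace 𝓘(ℝ, V) x) c.1
  obtain ⟨t, ht, hμt⟩ := FiberBundle.exists_contMDiffOn_extend (k := ∞) 𝓘(ℝ, V) (V →L[ℝ] ℝ)
    (V := Cotangent V) c.2
  have hst : SmoothSectionOn V (fun y =>
      (FiberBundle.extend V (E := fun x : M => TangentSpace 𝓘(ℝ, V) x) c.1 y,
        FiberBundle.extend (V →L[ℝ] ℝ) (E := Cotangent V) c.2 y)) (s ∩ t) :=
    ⟨hXs.mono Set.inter_subset_left, hμt.mono Set.inter_subset_right⟩
  obtain ⟨b, hb, hbc⟩ := hst.exists_smoothSection_eventuallyEq (inter_mem hs ht)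
  exact ⟨b, hb, hbc.self_of_nhds.trans (by simp)⟩

end Sections

section Courant

variable {V M : Type*} [NormedAddCommGroup V] [NormedSpace ℝ V] [TopologicalSpace M]
  [ChartedSpace V M]

lemma neutral_apply (x : M) (a b : BigTangent V x) : neutral V x a b = a.2 b.1 + b.2 a.1 := rfl

lemma neutral_comm (x : M) (a b : BigTangent V x) : neutral V x a b = neutral V x b a :=
  add_comm _ _

lemma eq_zero_of_neutral_eq_zero {x : M} {a : BigTangent V x} (h : ∀ b, neutral V x a b = 0) :
    a = 0 := by
  refine Prod.ext ?_ (ContinuousLinearMap.ext fun v => ?_)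
  · refine SeparatingDual.eq_zero_of_forall_dual_eq_zero (R := ℝ) (V := V) fun μ => ?_
    have hμ := h (0, μ)
    rwa [neutral_apply, map_zero, zero_add] at hμ
  · have hv := h (v, 0)
    rwa [neutral_apply, zero_apply, add_zero] at hv

lemma courant_skew (a b : ∀ x : M, BigTangent V x) (x : M) :
    courant V a b x = -courant V b a x := by
  have hpair : (fun y => (b y).2 (a y).1 - (a y).2 (b y).1) =
      -fun y => (a y).2 (b y).1 - (b y).2 (a y).1 := by
    ext y
    simp
  refine Prod.ext mlieBracket_swap_apply ?_
  simp only [courant, Prod.snd_neg]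
  rw [hpair, mvfderiv_neg]
  module

variable [CompleteSpace V] [IsManifold 𝓘(ℝ, V) ∞ M] {a b c : ∀ x : M, BigTangent V x} {x : M}

lemma neutral_courant (ha : DifferentiableSectionAt a x) (hb : DifferentiableSectionAt b x)
    (hc : DifferentiableSectionAt c x) :
    neutral V x (courant V a b x) (c x) =
      mvfderiv 𝓘(ℝ, V) (fun y => (b y).2 (c y).1) x (a x).1
        - mvfderiv 𝓘(ℝ, V) (fun y => (a y).2 (c y).1) x (b x).1
        + 1 / 2 * (mvfderiv 𝓘(ℝ, V) (fun y => (a y).2 (b y).1) x (c x).1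
          - mvfderiv 𝓘(ℝ, V) (fun y => (b y).2 (a y).1) x (c x).1)
        - (b x).2 (mlieBracket 𝓘(ℝ, V) (fun y => (a y).1) (fun y => (c y).1) x)
        + (a x).2 (mlieBracket 𝓘(ℝ, V) (fun y => (b y).1) (fun y => (c y).1) x)
        + (c x).2 (mlieBracket 𝓘(ℝ, V) (fun y => (a y).1) (fun y => (b y).1) x) := by
  have hd : mvfderiv 𝓘(ℝ, V) (fun y => (a y).2 (b y).1 - (b y).2 (a y).1) x =
      mvfderiv 𝓘(ℝ, V) (fun y => (a y).2 (b y).1) x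
        - mvfderiv 𝓘(ℝ, V) (fun y => (b y).2 (a y).1) x :=
    mvfderiv_sub (mdifferentiableAt_form_apply ha.2 hb.1) (mdifferentiableAt_form_apply hb.2 ha.1)
  simp only [neutral_apply, courant, hd, add_apply, sub_apply, smul_apply, smul_eq_mul,
    lieDerivForm_apply hb.2 hc.1, lieDerivForm_apply ha.2 hc.1]
  ring

lemma mvfderiv_neutral (ha : DifferentiableSectionAt a x) (hb : DifferentiableSectionAt b x)
    (hc : DifferentiableSectionAt c x) :
    mvfderiv 𝓘(ℝ, V) (fun y => neutral V y (b y) (c y)) x (a x).1 =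
      neutral V x (courant V a b x) (c x) + neutral V x (b x) (courant V a c x)
      + 1 / 2 * mvfderiv 𝓘(ℝ, V) (fun y => neutral V y (a y) (b y)) x (c x).1
      + 1 / 2 * mvfderiv 𝓘(ℝ, V) (fun y => neutral V y (a y) (c y)) x (b x).1 := by
  have hd {a b : ∀ x : M, BigTangent V x} (ha : DifferentiableSectionAt a x)
      (hb : DifferentiableSectionAt b x) (v : TangentSpace 𝓘(ℝ, V) x) :
      mvfderiv 𝓘(ℝ, V) (fun y => neutral V y (a y) (b y)) x v =
        mvfderiv 𝓘(ℝ, V) (fun y => (a y).2 (b y).1) x v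
          + mvfderiv 𝓘(ℝ, V) (fun y => (b y).2 (a y).1) x v :=
    congrArg (· v) (mvfderiv_add (mdifferentiableAt_form_apply ha.2 hb.1)
      (mdifferentiableAt_form_apply hb.2 ha.1))
  rw [neutral_comm x (b x), neutral_courant ha hb hc, neutral_courant ha hc hb, hd hb hc, hd ha hb,
    hd ha hc, mlieBracket_swap_apply (V := fun y => (c y).1) (W := fun y => (b y).1), map_neg]
  ring

end Courant

section Metric

variable {V M : Type*} [NormedAddCommGroup V] [NormedSpace ℝ V] [TopologicalSpace M]
  [ChartedSpace V M] [IsManifold 𝓘(ℝ, V) ∞ M]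

lemma Subbundle.exists_smooth_frame [FiniteDimensional ℝ V] [T2Space M] (E : Subbundle V M)
    (x : M) :
    ∃ s : Fin E.rank → ∀ y : M, BigTangent V y, (∀ i, SmoothSection V (s i)) ∧
      ∀ᶠ y in 𝓝 x, LinearIndependent ℝ (fun i => s i y) ∧
        Submodule.span ℝ (Set.range fun i => s i y) = E.fiber y := by
  obtain ⟨U, hU, hx, s, hs, hsU⟩ := E.exists_frame x
  choose t ht hts using fun i => (hs i).exists_smoothSection_eventuallyEq (hU.mem_nhds hx)
  refine ⟨t, ht, ?_⟩
  filter_upwards [eventually_all.2 hts, hU.mem_nhds hx] with y hy hyU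
  simpa only [hy] using hsU y hyU

namespace GenRiemannianMetric

variable (G : GenRiemannianMetric V M)

lemma form_apply (x : M) (a b : BigTangent V x) : G.form V x a b = neutral V x (G.φ x a) b := rfl

lemma neutral_φ_left (x : M) (a b : BigTangent V x) :
    neutral V x (G.φ x a) b = neutral V x a (G.φ x b) := by
  rw [← G.φ_isometry x a, G.φ_sq]

lemma neutral_eq_form (x : M) (a b : BigTangent V x) :
    neutral V x a b = G.form V x (G.φ x a) b := by
  rw [form_apply, G.φ_sq]

lemma form_comm (x : M) (a b : BigTangent V x) : G.form V x a b = G.form V x b a := by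
  rw [form_apply, neutral_φ_left, neutral_comm, form_apply]

lemma form_φ (x : M) (a b : BigTangent V x) : G.form V x (G.φ x a) (G.φ x b) = G.form V x a b := by
  rw [form_apply, G.φ_isometry, form_apply]

lemma anisotropic_form (x : M) :
    (LinearMap.BilinMap.toQuadraticMap (G.form V x)).Anisotropic := fun a ha => by
  by_contra hne
  exact (G.pos x a hne).ne' ha

lemma eq_of_form_eq {x : M} {W : Submodule ℝ (BigTangent V x)} {e e' : BigTangent V x}
    (he : e ∈ W) (he' : e' ∈ W) (h : ∀ c ∈ W, G.form V x e c = G.form V x e' c) : e = e' :=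
  sub_eq_zero.1 <| G.anisotropic_form x _ <| by
    rw [LinearMap.BilinMap.toQuadraticMap_apply, LinearMap.map_sub₂, h _ (sub_mem he he'), sub_self]

lemma contMDiff_form {a b : ∀ x : M, BigTangent V x} (ha : SmoothSection V a)
    (hb : SmoothSection V b) : CMDiff ∞ (fun x => G.form V x (a x) (b x)) := fun x =>
  contMDiffAt_neutral ((G.smooth a ha).smoothSectionAt x) (hb.smoothSectionAt x)

variable [FiniteDimensional ℝ V] (E : Subbundle V M) {x : M}

lemma isCompl_orthogonal (x : M) :
    IsCompl (E.fiber x) (LinearMap.BilinForm.orthogonal (G.form V x) (E.fiber x)) := by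
  have : FiniteDimensional ℝ (BigTangent V x) :=
    inferInstanceAs (FiniteDimensional ℝ (V × (V →L[ℝ] ℝ)))
  refine LinearMap.BilinForm.isCompl_orthogonal_of_restrict_nondegenerate
    (fun a b h => by rw [← h, form_comm]) ⟨fun e he => ?_, fun e he => ?_⟩ <;>
  exact Subtype.ext (G.anisotropic_form x _ (he e))

/-- The `G`-orthogonal projection of `𝐓M` onto a subbundle. -/
def proj (x : M) : BigTangent V x →ₗ[ℝ] E.fiber x :=
  (E.fiber x).projectionOnto _ (G.isCompl_orthogonal E x)

variable {E}

lemma form_proj_left (a : BigTangent V x) {e : BigTangent V x} (he : e ∈ E.fiber x) :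
    G.form V x (G.proj E x a) e = G.form V x a e := by
  have h : a - G.proj E x a ∈ LinearMap.BilinForm.orthogonal (G.form V x) (E.fiber x) := by
    rw [← Submodule.projectionOnto_apply_eq_zero_iff (G.isCompl_orthogonal E x), map_sub,
      Submodule.projectionOnto_apply_left]
    exact sub_self _
  have h' : G.form V x e (a - G.proj E x a) = 0 := h e he
  rw [map_sub, sub_eq_zero] at h'
  rw [form_comm, ← h', form_comm]

lemma proj_of_mem {e : BigTangent V x} (he : e ∈ E.fiber x) : G.proj E x e = ⟨e, he⟩ :=
  Submodule.projectionOnto_apply_of_mem_left _ he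

lemma smoothSection_proj [T2Space M] {a : ∀ x : M, BigTangent V x} (ha : SmoothSection V a) :
    SmoothSection V (fun x => (G.proj E x (a x) : BigTangent V x)) := by
  refine smoothSection_iff.2 fun x => ?_
  obtain ⟨s, hs, hsE⟩ := E.exists_smooth_frame x
  let A (y : M) : Matrix (Fin E.rank) (Fin E.rank) ℝ := .of fun i j => G.form V y (s j y) (s i y)
  have hdet : ∀ᶠ y in 𝓝 x, (A y).det ≠ 0 :=
    hsE.mono fun y hy => det_gram_ne_zero (G.anisotropic_form y) hy.1
  have hA (i j) : CMDiffAt ∞ (fun y => A y i j) x := G.contMDiff_form (hs j) (hs i) x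
  have hcramer (i) : CMDiffAt ∞ (fun y => (A y).cramer (fun j => G.form V y (a y) (s j y)) i) x :=
    contMDiffAt_cramer hA (fun j => G.contMDiff_form ha (hs j) x) i
  have hsum : SmoothSectionAt (fun y => ∑ i,
      ((A y).det⁻¹ * (A y).cramer (fun j => G.form V y (a y) (s j y)) i) • s i y) x :=
    .sum fun i _ => .smul (((contMDiffAt_det hA).inv₀ hdet.self_of_nhds).mul (hcramer i))
      ((hs i).smoothSectionAt x)
  refine hsum.congr_of_eventuallyEq ?_
  filter_upwards [hsE, hdet] with y hy hydet
  have hmem (i) : s i y ∈ E.fiber y := hy.2 ▸ Submodule.subset_span ⟨i, rfl⟩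
  have hproj := eq_sum_cramer_gram hydet (p := (G.proj E y (a y) : BigTangent V y))
    (by rw [hy.2]; exact Subtype.property _)
  simpa only [form_proj_left G _ (hmem _)] using hproj

end GenRiemannianMetric

end Metric

section TwoNilpotent

variable {V M : Type*} [NormedAddCommGroup V] [NormedSpace ℝ V] [TopologicalSpace M]
  [ChartedSpace V M] [IsManifold 𝓘(ℝ, V) ∞ M]
  {τ : ∀ x : M, BigTangent V x →ₗ[ℝ] BigTangent V x}

namespace IsTwoNilpotent

lemma neutral_left (h : IsTwoNilpotent V τ) (x : M) (a b : BigTangent V x) :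
    neutral V x (τ x a) b = -neutral V x a (τ x b) :=
  eq_neg_of_add_eq_zero_right (h.skew x a b)

lemma neutral_apply_apply (h : IsTwoNilpotent V τ) (x : M) (a b : BigTangent V x) :
    neutral V x (τ x a) (τ x b) = 0 := by
  rw [h.neutral_left, h.sq, map_zero, neg_zero]

lemma mvfderiv_neutral_apply [CompleteSpace V] (h : IsTwoNilpotent V τ)
    {a b c : ∀ x : M, BigTangent V x} (ha : SmoothSection V a) (hb : SmoothSection V b)
    (hc : SmoothSection V c) (x : M) :
    mvfderiv 𝓘(ℝ, V) (fun y => neutral V y (τ y (b y)) (c y)) x (τ x (a x)).1 =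
      neutral V x (τ x (courant V (fun y => τ y (a y)) b x)) (c x)
      - neutral V x (courant V (fun y => τ y (a y)) (fun y => τ y (c y)) x) (b x)
      - 1 / 2 * mvfderiv 𝓘(ℝ, V) (fun y => neutral V y (τ y (a y)) (b y)) x (τ x (c x)).1 := by
  have hskew : (fun y => neutral V y (τ y (b y)) (c y)) = -fun y => neutral V y (b y) (τ y (c y)) :=
    funext fun y => h.neutral_left y _ _
  have hisotropic : (fun y => neutral V y (τ y (a y)) (τ y (c y))) = 0 :=
    funext fun y => h.neutral_apply_apply y _ _
  have hcourant := mvfderiv_neutral ((h.smooth a ha).differentiableSectionAt x)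
    (hb.differentiableSectionAt x) ((h.smooth c hc).differentiableSectionAt x)
  rw [hisotropic, mvfderiv_zero, zero_apply, mul_zero, add_zero] at hcourant
  rw [hskew, mvfderiv_neg, neg_apply, hcourant, h.neutral_left, neutral_comm x (b x)]
  ring

lemma neutral_nijenhuis [CompleteSpace V] (h : IsTwoNilpotent V τ)
    {a b c : ∀ x : M, BigTangent V x} (ha : SmoothSection V a) (hb : SmoothSection V b)
    (hc : SmoothSection V c) (x : M) :
    neutral V x (nijenhuis V τ a b x) (c x) =
      -(mvfderiv 𝓘(ℝ, V) (fun y => neutral V y (τ y (b y)) (c y)) x (τ x (a x)).1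
        - mvfderiv 𝓘(ℝ, V) (fun y => neutral V y (τ y (a y)) (c y)) x (τ x (b x)).1
        + mvfderiv 𝓘(ℝ, V) (fun y => neutral V y (τ y (a y)) (b y)) x (τ x (c x)).1
        - neutral V x (courant V (fun y => τ y (a y)) (fun y => τ y (b y)) x) (c x)
        + neutral V x (courant V (fun y => τ y (a y)) (fun y => τ y (c y)) x) (b x)
        - neutral V x (courant V (fun y => τ y (b y)) (fun y => τ y (c y)) x) (a x)) := by
  have hskew : (fun y => neutral V y (τ y (b y)) (a y)) = -fun y => neutral V y (τ y (a y)) (b y) :=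
    funext fun y => by rw [h.neutral_left, neutral_comm]; rfl
  rw [h.mvfderiv_neutral_apply ha hb hc, h.mvfderiv_neutral_apply hb ha hc, hskew, mvfderiv_neg,
    courant_skew _ a, nijenhuis, h.sq]
  simp only [map_add, map_sub, map_neg, neg_apply, LinearMap.zero_apply, map_zero,
    LinearMap.add_apply, LinearMap.sub_apply, LinearMap.neg_apply]
  ring

end IsTwoNilpotent

end TwoNilpotent

section Correspondence

variable {V M : Type*} [NormedAddCommGroup V] [NormedSpace ℝ V] [TopologicalSpace M]
  [ChartedSpace V M] [IsManifold 𝓘(ℝ, V) ∞ M] {G : GenRiemannianMetric V M} {E : Subbundle V M}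
  {τ : ∀ x : M, BigTangent V x →ₗ[ℝ] BigTangent V x} {lam : ∀ x : M, E.fiber x →ₗ[ℝ] E.fiber x}

namespace MetricTwoNilpotent

lemma apply_mem (h : τ ∈ MetricTwoNilpotent V G E) (x : M) (a : BigTangent V x) :
    τ x a ∈ E.fiber x :=
  h.2.1 x ▸ LinearMap.mem_range_self _ a

/-- The complex structure `τ ∘ φ|_E` on `E` associated with `τ`. -/
def toComplex (h : τ ∈ MetricTwoNilpotent V G E) (x : M) : E.fiber x →ₗ[ℝ] E.fiber x :=
  ((τ x).comp (G.φ x)).restrict fun _ _ => apply_mem h x _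

lemma coe_toComplex (h : τ ∈ MetricTwoNilpotent V G E) (x : M) (e : E.fiber x) :
    (toComplex h x e : BigTangent V x) = τ x (G.φ x e) := rfl

lemma form_toComplex_left (h : τ ∈ MetricTwoNilpotent V G E) (x : M) (e e' : E.fiber x) :
    G.form V x (toComplex h x e) e' = -G.form V x e (toComplex h x e') := by
  rw [G.form_apply, G.neutral_φ_left, coe_toComplex, h.1.neutral_left, G.form_apply, coe_toComplex]

lemma form_toComplex (h : τ ∈ MetricTwoNilpotent V G E) (x : M) (e e' : E.fiber x) :
    G.form V x (toComplex h x e) (toComplex h x e') = G.form V x e e' := by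
  have hmem (e : E.fiber x) : G.φ x e ∈ (LinearMap.range (τ x)).map (G.φ x) :=
    Submodule.mem_map_of_mem (by rw [h.2.1 x]; exact e.2)
  rw [coe_toComplex, coe_toComplex, h.2.2 x _ (hmem e) _ (hmem e'), G.form_φ]

lemma toComplex_toComplex (h : τ ∈ MetricTwoNilpotent V G E) (x : M) (e : E.fiber x) :
    toComplex h x (toComplex h x e) = -e :=
  Subtype.ext <| G.eq_of_form_eq (Subtype.property _) (Subtype.property _) fun c hc => by
    rw [form_toComplex_left h x _ ⟨c, hc⟩, form_toComplex, Submodule.coe_neg, LinearMap.map_neg₂]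

lemma isAlmostHermitian_toComplex (h : τ ∈ MetricTwoNilpotent V G E) :
    IsAlmostHermitian V G E (toComplex h) where
  smooth _ he := h.1.smooth _ (G.smooth _ he)
  sq := toComplex_toComplex h
  compat := form_toComplex h

lemma exists_eq_apply (h : τ ∈ MetricTwoNilpotent V G E) {e : ∀ x : M, E.fiber x}
    (he : E.IsSection V e) :
    ∃ a : ∀ x : M, BigTangent V x, SmoothSection V a ∧
      e = fun x => ⟨τ x (a x), apply_mem h x _⟩ := by
  refine ⟨fun x => G.φ x (-toComplex h x (e x) : BigTangent V x),
    G.smooth _ ((isAlmostHermitian_toComplex h).smooth e he).neg, funext fun x => Subtype.ext ?_⟩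
  have hsq := congrArg Subtype.val (toComplex_toComplex h x (e x))
  rw [coe_toComplex, Submodule.coe_neg] at hsq
  simp only [map_neg, hsq, neg_neg]

lemma fundamentalForm_apply (h : τ ∈ MetricTwoNilpotent V G E) (x : M) (e : E.fiber x)
    (c : BigTangent V x) :
    fundamentalForm V G E (toComplex h) x e ⟨τ x c, apply_mem h x c⟩ = neutral V x e c :=
  calc G.form V x (toComplex h x e) (τ x c)
    _ = -neutral V x (toComplex h x (toComplex h x e)) c := by
      rw [coe_toComplex h x (toComplex h x e), h.1.neutral_left, neg_neg, G.form_apply]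
    _ = neutral V x e c := by
      rw [toComplex_toComplex, Submodule.coe_neg, LinearMap.map_neg₂, neg_neg]

lemma dTwoForm_fundamentalForm [CompleteSpace V] (h : τ ∈ MetricTwoNilpotent V G E)
    (hE : E.CourantClosed V) {a b c : ∀ x : M, BigTangent V x} (ha : SmoothSection V a)
    (hb : SmoothSection V b) (hc : SmoothSection V c) (x : M) :
    E.dTwoForm V hE (fundamentalForm V G E (toComplex h))
      (fun x => ⟨τ x (a x), apply_mem h x _⟩) (fun x => ⟨τ x (b x), apply_mem h x _⟩)
      (fun x => ⟨τ x (c x), apply_mem h x _⟩) (h.1.smooth a ha) (h.1.smooth b hb)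
      (h.1.smooth c hc) x = -neutral V x (nijenhuis V τ a b x) (c x) := by
  rw [h.1.neutral_nijenhuis ha hb hc, neg_neg]
  simp only [Subbundle.dTwoForm, fundamentalForm_apply, Subbundle.bracket]

lemma courantClosed_of_isIntegrable (h : τ ∈ MetricTwoNilpotent V G E) (hτ : IsIntegrable V τ) :
    E.CourantClosed V := by
  intro e₁ e₂ h₁ h₂ x
  obtain ⟨a, ha, rfl⟩ := exists_eq_apply h h₁
  obtain ⟨b, hb, rfl⟩ := exists_eq_apply h h₂
  have hN := hτ a b ha hb x
  rw [nijenhuis, h.1.sq, add_zero, sub_sub, sub_eq_zero] at hN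
  rw [hN]
  exact add_mem (apply_mem h x _) (apply_mem h x _)

lemma isIntegrable_iff [FiniteDimensional ℝ V] [T2Space M] (h : τ ∈ MetricTwoNilpotent V G E) :
    IsIntegrable V τ ↔ ∃ hE : E.CourantClosed V, IsAlmostKahler V G E hE (toComplex h) := by
  have : CompleteSpace V := FiniteDimensional.complete ℝ V
  refine ⟨fun hτ => ⟨courantClosed_of_isIntegrable h hτ, isAlmostHermitian_toComplex h,
    fun e₁ e₂ e₃ h₁ h₂ h₃ x => ?_⟩, ?_⟩
  · obtain ⟨a, ha, rfl⟩ := exists_eq_apply h h₁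
    obtain ⟨b, hb, rfl⟩ := exists_eq_apply h h₂
    obtain ⟨c, hc, rfl⟩ := exists_eq_apply h h₃
    rw [dTwoForm_fundamentalForm h _ ha hb hc, hτ a b ha hb, LinearMap.map_zero₂, neg_zero]
  · rintro ⟨hE, -, hclosed⟩ a b ha hb x
    refine eq_zero_of_neutral_eq_zero fun c => ?_
    obtain ⟨c, hc, rfl⟩ := exists_smoothSection_eq c
    rw [← neg_eq_zero, ← dTwoForm_fundamentalForm h hE ha hb hc]
    exact hclosed ..

end MetricTwoNilpotent

lemma Subbundle.finrank_fiber (E : Subbundle V M) (x : M) :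
    Module.finrank ℝ (E.fiber x) = E.rank := by
  obtain ⟨U, -, hx, s, -, hs⟩ := E.exists_frame x
  rw [← (hs x hx).2, finrank_span_eq_card (hs x hx).1, Fintype.card_fin]

lemma IsAlmostHermitian.form_left (h : IsAlmostHermitian V G E lam) (x : M) (e e' : E.fiber x) :
    G.form V x (lam x e) e' = -G.form V x e (lam x e') := by
  rw [← h.compat x (lam x e) e', h.sq, Submodule.coe_neg, LinearMap.map_neg₂]

variable [FiniteDimensional ℝ V]

lemma Subbundle.IsIsotropic.proj_φ (hE : E.IsIsotropic V) {x : M} {e : BigTangent V x}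
    (he : e ∈ E.fiber x) : G.proj E x (G.φ x e) = 0 :=
  Subtype.ext <| G.eq_of_form_eq (Subtype.property _) (Subtype.property _) fun c hc => by
    rw [G.form_proj_left _ hc, ← G.neutral_eq_form, hE x e he c hc, Submodule.coe_zero,
      LinearMap.map_zero₂]

variable (G) in
/-- The 2-nilpotent structure associated with a complex structure `lam` on `E`: it is `lam ∘ φ` on
`φ(E)` and vanishes on the `G`-orthogonal complement of `φ(E)`. -/
def nilpotentOfComplex (lam : ∀ x : M, E.fiber x →ₗ[ℝ] E.fiber x) (x : M) :
    BigTangent V x →ₗ[ℝ] BigTangent V x :=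
  (E.fiber x).subtype.comp ((lam x).comp ((G.proj E x).comp (G.φ x)))

lemma nilpotentOfComplex_apply (x : M) (a : BigTangent V x) :
    nilpotentOfComplex G lam x a = lam x (G.proj E x (G.φ x a)) := rfl

lemma nilpotentOfComplex_φ (x : M) (e : E.fiber x) :
    nilpotentOfComplex G lam x (G.φ x e) = lam x e := by
  rw [nilpotentOfComplex_apply, G.φ_sq, G.proj_of_mem e.2]

lemma neutral_nilpotentOfComplex (x : M) (a b : BigTangent V x) :
    neutral V x a (nilpotentOfComplex G lam x b)
      = G.form V x (G.proj E x (G.φ x a)) (lam x (G.proj E x (G.φ x b))) := by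
  rw [G.neutral_eq_form, G.form_proj_left _ (Subtype.property _), nilpotentOfComplex_apply]

lemma nilpotentOfComplex_toComplex (h : τ ∈ MetricTwoNilpotent V G E) :
    nilpotentOfComplex G (MetricTwoNilpotent.toComplex h) = τ := by
  refine funext fun x => LinearMap.ext fun a =>
    sub_eq_zero.1 (eq_zero_of_neutral_eq_zero fun b => ?_)
  rw [nilpotentOfComplex_apply, MetricTwoNilpotent.coe_toComplex, LinearMap.map_sub₂,
    h.1.neutral_left, h.1.neutral_left, ← G.form_apply,
    G.form_proj_left _ (MetricTwoNilpotent.apply_mem h x b), ← G.neutral_eq_form, sub_self]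

namespace IsAlmostHermitian

lemma range_nilpotentOfComplex (h : IsAlmostHermitian V G E lam) (x : M) :
    LinearMap.range (nilpotentOfComplex G lam x) = E.fiber x := by
  refine le_antisymm ?_ fun e he => ⟨G.φ x (lam x (-⟨e, he⟩)), ?_⟩
  · rintro _ ⟨a, rfl⟩
    exact Subtype.property _
  · rw [nilpotentOfComplex_φ, h.sq]
    exact neg_neg e

lemma isTwoNilpotent_nilpotentOfComplex [T2Space M] (hE : E.IsIsotropic V)
    (h : IsAlmostHermitian V G E lam) : IsTwoNilpotent V (nilpotentOfComplex G lam) where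
  smooth a ha := h.smooth _ (G.smoothSection_proj (G.smooth a ha))
  sq x a := by
    rw [nilpotentOfComplex_apply, nilpotentOfComplex_apply, hE.proj_φ (Subtype.property _),
      LinearMap.map_zero, Submodule.coe_zero]
  skew x a b := by
    rw [neutral_comm x (nilpotentOfComplex G lam x a), neutral_nilpotentOfComplex,
      neutral_nilpotentOfComplex, G.form_comm x (G.proj E x (G.φ x b)), h.form_left,
      add_neg_cancel]
  const_rank := ⟨E.rank, fun x => by rw [h.range_nilpotentOfComplex, E.finrank_fiber]⟩

lemma isCompatible_nilpotentOfComplex (h : IsAlmostHermitian V G E lam) :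
    IsCompatible V G (nilpotentOfComplex G lam) := by
  rintro x _ ⟨e, he, rfl⟩ _ ⟨e', he', rfl⟩
  rw [h.range_nilpotentOfComplex] at he he'
  rw [nilpotentOfComplex_φ x ⟨e, he⟩, nilpotentOfComplex_φ x ⟨e', he'⟩, h.compat, G.form_φ]

end IsAlmostHermitian

variable (G) in
/-- The bijection `τ ↦ τ ∘ φ|_E` from metric 2-nilpotent structures with image `E` to compatible
complex structures on `E`. -/
def nilpotentEquivComplex [T2Space M] (hE : E.IsIsotropic V) :
    MetricTwoNilpotent V G E ≃ CompatibleComplex V G E where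
  toFun τ := ⟨_, MetricTwoNilpotent.isAlmostHermitian_toComplex τ.2⟩
  invFun lam := ⟨nilpotentOfComplex G lam.1, lam.2.isTwoNilpotent_nilpotentOfComplex hE,
    lam.2.range_nilpotentOfComplex, lam.2.isCompatible_nilpotentOfComplex⟩
  left_inv τ := Subtype.ext (nilpotentOfComplex_toComplex τ.2)
  right_inv _ := Subtype.ext <| funext fun x => LinearMap.ext fun e =>
    Subtype.ext (nilpotentOfComplex_φ x e)

end Correspondence

end GenGeom

end

theorem proposition5p2
    {V : Type*} [NormedAddCommGroup V] [NormedSpace ℝ V] [FiniteDimensional ℝ V]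
    {M : Type*} [TopologicalSpace M] [T2Space M] [ChartedSpace V M] [IsManifold 𝓘(ℝ, V) ∞ M]
    (G : GenGeom.GenRiemannianMetric V M) (E : GenGeom.Subbundle V M) (hE : E.IsIsotropic V) :
    ∃ Φ : GenGeom.MetricTwoNilpotent V G E ≃ GenGeom.CompatibleComplex V G E,
      (∀ (τ : GenGeom.MetricTwoNilpotent V G E) (x : M) (e : E.fiber x),
        ((Φ τ).1 x e : GenGeom.BigTangent V x) = τ.1 x (G.φ x e)) ∧
      ∀ τ : GenGeom.MetricTwoNilpotent V G E,
        GenGeom.IsIntegrable V τ.1 ↔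
          ∃ h : E.CourantClosed V, GenGeom.IsAlmostKahler V G E h (Φ τ).1 :=
  ⟨GenGeom.nilpotentEquivComplex G hE, fun _ _ _ => rfl,
    fun τ => GenGeom.MetricTwoNilpotent.isIntegrable_iff τ.2⟩
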